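/- Let $n\ge 2$ and let $k$ be an integer with $-1\le k\le n-2$. Let $E\subset\mathbb{R}^n$ be a smooth closed (that is, compact and without boundary) embedded submanifold of dimension $k$, where for $k=-1$ this means $E=\emptyset$, and let $\Omega\subset\mathbb{R}^n$ be a domain (a bounded connected open set); $E$ is not assumed to be contained in $\Omega$. For a $C^2$ function $u$ let $\lambda_1(\nabla^2u)\le\lambda_2(\nabla^2u)\le\cdots\le\lambda_n(\nabla^2u)$ denote the eigenvalues of its Hessian, counted with multiplicity. Assume that $u\in C^2(\Omega\setminus E)\cap C^0(\overline\Omega\setminus E)$ is real-valued and satisfies $$\lambda_1(\nabla^2u)+\cdots+\lambda_{k+2}(\nabla^2u)\le 0\quad\text{in }\Omega\setminus E,\qquad \inf_{\Omega\setminus E}u>-\infty.$$ Then $$u\ \ge\ \inf_{\partial\Omega\setminus E}u\qquad\text{on }\Omega\setminus E.$$ -/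

import Mathlib

open scoped ContDiff

/-- `E ⊆ ℝⁿ` is a smooth closed (that is, compact and without boundary) embedded submanifold of
dimension `k`: it is compact, and near each of its points a smooth diffeomorphism `Φ` between open
subsets of `ℝⁿ` flattens `E` onto `ℝᵏ × {0}` (the coordinates with 0-based index `≥ k` vanish).
A submanifold of negative dimension (in particular of dimension `-1`) is empty. -/
def IsSmoothClosedSubmanifold {n : ℕ} (k : ℤ) (E : Set (EuclideanSpace ℝ (Fin n))) : Prop :=
  IsCompact E ∧ (k < 0 → E = ∅) ∧
    ∀ p ∈ E, ∃ Φ : OpenPartialHomeomorph (EuclideanSpace ℝ (Fin n)) (EuclideanSpace ℝ (Fin n)),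
      p ∈ Φ.source ∧ ContDiffOn ℝ ∞ Φ Φ.source ∧ ContDiffOn ℝ ∞ Φ.symm Φ.target ∧
        ∀ x ∈ Φ.source, (x ∈ E ↔ ∀ i : Fin n, k ≤ (i : ℤ) → Φ x i = 0)

/-- The Hessian matrix `∇²u(x)`, with entries `∂ᵢ∂ⱼu(x)`. -/
noncomputable def hessianMatrix {n : ℕ} (u : EuclideanSpace ℝ (Fin n) → ℝ)
    (x : EuclideanSpace ℝ (Fin n)) : Matrix (Fin n) (Fin n) ℝ :=
  Matrix.of fun i j =>
    iteratedFDeriv ℝ 2 u x ![EuclideanSpace.single i 1, EuclideanSpace.single j 1]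

/-- The `i`-th smallest eigenvalue, `i = 1, …, n`, of a real symmetric matrix `A`: the eigenvalues
are the roots of the characteristic polynomial, counted with multiplicity, listed in
nondecreasing order (and `i - 1` is the 0-based position in this list). -/
noncomputable def orderedEigenvalue {n : ℕ} (A : Matrix (Fin n) (Fin n) ℝ) (i : ℕ) : ℝ :=
  (A.charpoly.roots.sort (· ≤ ·)).getD (i - 1) 0

open scoped Topology
open Filter

/-! Suppose `u` dips below its infimum over `∂Ω \ E`. So does `v = u - δ|x|²` below its own, for
small `δ > 0`, and `v` has no local minimum in `Ω \ E`, since there `∇²u ≥ 2δ`. Hence the infimum of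
`v` is approached only at `E`. Let `d` be the distance to `E`. Since `log d² + A d → -∞` at `E` and
`v` is bounded below, subtracting a small multiple of it forces a local minimum near `E`
(`exists_isLocalMin_sub_barrier`).

This is impossible, because near `E` the Hessian of the barrier has positive sum over every
orthonormal `(k+2)`-frame (`HasUniformTangents.not_isLocalMin_sub_barrier`). For flat `E`, the
eigenvalues of `∇² log d²` are `-2/d²` once, `0` on the `k` tangent directions and `2/d²` otherwise,
so the lowest `k+2` sum to exactly zero. Curvature costs `O(1/d)`, which the gain `A/d` from `A d`
outweighs.

Smoothness of `d` is not needed: along each line `d²` has a quadratic minorant with equality at the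
base point (`eventually_quadratic_le_infDist_sq`). -/

/-! ### Eigenvalue sums as sums over orthonormal frames -/

theorem sort_roots_charpoly_eq_ofFn {n : ℕ} {A : Matrix (Fin n) (Fin n) ℝ} (hA : A.IsHermitian) :
    A.charpoly.roots.sort (· ≤ ·) = List.ofFn (hA.eigenvalues ∘ Tuple.sort hA.eigenvalues) := by
  refine List.Perm.eq_of_sortedLE ?_ ?_ ?_
  · exact (Multiset.pairwise_sort _ _).sortedLE
  · exact (Tuple.monotone_sort hA.eigenvalues).sortedLE_ofFn
  · rw [← Multiset.coe_eq_coe, Multiset.sort_eq, hA.roots_charpoly_eq_eigenvalues,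
      Multiset.coe_eq_coe.2 (Equiv.Perm.ofFn_comp_perm _ _), Fin.univ_val_map]
    rfl

theorem exists_orthonormal_sum_orderedEigenvalue {n m : ℕ} (hm : m ≤ n)
    {A : Matrix (Fin n) (Fin n) ℝ} (hA : A.IsHermitian) :
    ∃ w : Fin m → EuclideanSpace ℝ (Fin n), Orthonormal ℝ w ∧
      ∑ i ∈ Finset.Icc 1 m, orderedEigenvalue A i =
        ∑ i, ∑ a, ∑ b, w i a * w i b * A a b := by
  set σ := Tuple.sort hA.eigenvalues
  refine ⟨fun i => hA.eigenvectorBasis (σ (Fin.castLE hm i)), ?_, ?_⟩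
  · exact hA.eigenvectorBasis.orthonormal.comp _ (σ.injective.comp (Fin.castLE_injective hm))
  · have h1 : ∀ j, ∑ a, ∑ b, hA.eigenvectorBasis j a * hA.eigenvectorBasis j b * A a b
        = hA.eigenvalues j := by
      intro j
      have h2 := hA.mulVec_eigenvectorBasis j
      have h3 : ∀ a, ∑ b, hA.eigenvectorBasis j a * hA.eigenvectorBasis j b * A a b
          = hA.eigenvalues j * (hA.eigenvectorBasis j a) ^ 2 := by
        intro a
        have h4 := congrFun h2 a
        simp only [Matrix.mulVec, dotProduct, Pi.smul_apply, smul_eq_mul] at h4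
        calc _ = hA.eigenvectorBasis j a * ∑ b, A a b * hA.eigenvectorBasis j b := by
              rw [Finset.mul_sum]
              exact Finset.sum_congr rfl fun b _ => by ring
          _ = _ := by rw [h4]; ring
      simp only [h3]
      rw [← Finset.mul_sum]
      have h5 := hA.eigenvectorBasis.orthonormal.1 j
      have h6 := EuclideanSpace.real_norm_sq_eq (hA.eigenvectorBasis j)
      rw [h5] at h6
      rw [← h6]; ring
    simp only [h1]
    have h2 : Finset.Icc 1 m = Finset.Ico (0 + 1) (m + 1) := by ext; simp
    rw [h2, ← Finset.sum_Ico_add' (fun i => orderedEigenvalue A i) 0 m 1, ← Finset.range_eq_Ico,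
      Finset.sum_range]
    refine Finset.sum_congr rfl fun i _ => ?_
    -- The position is below `m ≤ n`, so the default `0` of `getD` never occurs.
    rw [orderedEigenvalue, sort_roots_charpoly_eq_ofFn hA, Nat.add_sub_cancel,
      List.getD_eq_getElem _ _ (by simpa using i.2.trans_le hm)]
    simp [σ, Fin.castLE]

/-! ### Second derivatives along lines -/

/-- Second-order necessary condition at a local minimum. -/
theorem IsLocalMin.second_deriv_nonneg {f f' : ℝ → ℝ} {x c : ℝ} (h : IsLocalMin f x)
    (hf : ∀ᶠ t in 𝓝 x, HasDerivAt f (f' t) t) (hf' : HasDerivAt f' c x) : 0 ≤ c := by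
  by_contra! hc
  have e : deriv f =ᶠ[𝓝 x] f' := hf.mono fun t ht => ht.deriv
  have h1 : deriv (deriv f) x = c := by rw [e.deriv_eq, hf'.deriv]
  -- A local minimum that is also a local maximum makes `f` locally constant, whence `c = 0`.
  have h2 : IsLocalMax f x := isLocalMax_of_deriv_deriv_neg (by rwa [h1]) h.deriv_eq_zero
    hf.self_of_nhds.continuousAt
  have h3 : f =ᶠ[𝓝 x] fun _ => f x := by
    filter_upwards [h, h2] with t a b using le_antisymm b a
  have h4 : deriv f =ᶠ[𝓝 x] fun _ => 0 := by
    simpa using h3.deriv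
  rw [h4.deriv_eq] at h1
  simp at h1
  exact hc.ne h1.symm

theorem ContDiffAt.line_second_deriv {F : Type*} [NormedAddCommGroup F] [NormedSpace ℝ F]
    {u : F → ℝ} {x : F} (hu : ContDiffAt ℝ 2 u x) (w : F) :
    (∀ᶠ t in 𝓝 (0 : ℝ), HasDerivAt (fun t : ℝ => u (x + t • w)) (fderiv ℝ u (x + t • w) w) t) ∧
    HasDerivAt (fun t : ℝ => fderiv ℝ u (x + t • w) w) (iteratedFDeriv ℝ 2 u x ![w, w]) 0 := by
  have hl : ∀ t : ℝ, HasDerivAt (fun t : ℝ => x + t • w) w t := fun t => by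
    simpa using ((hasDerivAt_id t).smul_const w).const_add x
  have hc : Tendsto (fun t : ℝ => x + t • w) (𝓝 0) (𝓝 x) := by
    simpa using (hl 0).continuousAt.tendsto
  constructor
  · have h1 : ∀ᶠ y in 𝓝 x, DifferentiableAt ℝ u y :=
      (hu.eventually (by simp)).mono fun y hy => hy.differentiableAt (by simp)
    filter_upwards [hc.eventually h1] with t ht
    exact ht.hasFDerivAt.comp_hasDerivAt t (hl t)
  · have h1 : DifferentiableAt ℝ (fderiv ℝ u) (x + (0 : ℝ) • w) := by
      simpa using (hu.fderiv_right (m := 1) (by norm_num)).differentiableAt (by simp)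
    have h2 := h1.hasFDerivAt.comp_hasDerivAt (0 : ℝ) (hl 0)
    have h3 := h2.clm_apply (hasDerivAt_const (0 : ℝ) w)
    refine h3.congr_deriv ?_
    simp [iteratedFDeriv_two_apply]

theorem isHermitian_hessianMatrix {n : ℕ} {u : EuclideanSpace ℝ (Fin n) → ℝ}
    {x : EuclideanSpace ℝ (Fin n)} (hu : ContDiffAt ℝ 2 u x) : (hessianMatrix u x).IsHermitian := by
  ext i j
  have := (hu.isSymmSndFDerivAt (by simp)).eq (EuclideanSpace.single i (1 : ℝ))
    (EuclideanSpace.single j 1)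
  simp [hessianMatrix, iteratedFDeriv_two_apply, this]

theorem sum_hessianMatrix_eq {n : ℕ} (u : EuclideanSpace ℝ (Fin n) → ℝ)
    (x w : EuclideanSpace ℝ (Fin n)) :
    ∑ a, ∑ b, w a * w b * hessianMatrix u x a b = iteratedFDeriv ℝ 2 u x ![w, w] := by
  have hw : w = ∑ a, w a • EuclideanSpace.single a (1 : ℝ) := by
    simpa using ((EuclideanSpace.basisFun (Fin n) ℝ).sum_repr w).symm
  simp only [hessianMatrix, iteratedFDeriv_two_apply, Matrix.of_apply, Matrix.cons_val_zero,
    Matrix.cons_val_one]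
  conv_rhs => rw [hw]
  simp only [map_sum, map_smul, _root_.sum_apply, _root_.smul_apply,
    smul_eq_mul, Finset.mul_sum]
  rw [Finset.sum_comm]
  refine Finset.sum_congr rfl fun a _ => Finset.sum_congr rfl fun b _ => by ring

/-- The first two derivatives of `log q + A √q` along a quadratic `q`. -/
theorem hasDerivAt_log_add_sqrt_quadratic {d : ℝ} (hd : 0 < d) (A β b : ℝ) :
    ∃ f' : ℝ → ℝ, (∀ᶠ t in 𝓝 (0 : ℝ), HasDerivAt (fun t : ℝ =>
        Real.log (d ^ 2 + 2 * t * β + t ^ 2 * b) + A * √(d ^ 2 + 2 * t * β + t ^ 2 * b)) (f' t) t) ∧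
      HasDerivAt f' (2 * b / d ^ 2 - 4 * β ^ 2 / d ^ 4 + A * (b / d - β ^ 2 / d ^ 3)) 0 := by
  set q : ℝ → ℝ := fun t => d ^ 2 + 2 * t * β + t ^ 2 * b with hq
  have hq' : ∀ t, HasDerivAt q (2 * β + 2 * t * b) t := by
    intro t
    refine (((((hasDerivAt_id t).const_mul 2).mul_const β).const_add (d ^ 2)).add
      ((hasDerivAt_pow 2 t).mul_const b)).congr_deriv ?_
    simp
  have hq'' : HasDerivAt (fun t : ℝ => 2 * β + 2 * t * b) (2 * b) 0 := by
    simpa using (((hasDerivAt_id (0 : ℝ)).const_mul 2).mul_const b).const_add (2 * β)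
  have hpos : ∀ᶠ t in 𝓝 (0 : ℝ), 0 < q t :=
    (hq' 0).continuousAt.eventually (lt_mem_nhds (by simp [hq]; positivity))
  refine ⟨fun t => (2 * β + 2 * t * b) / q t + A * ((2 * β + 2 * t * b) / (2 * √(q t))), ?_, ?_⟩
  · filter_upwards [hpos] with t ht
    exact ((hq' t).log ht.ne').add (((hq' t).sqrt ht.ne').const_mul A)
  · have h0 : q 0 = d ^ 2 := by simp [hq]
    have hs : √(q 0) = d := by rw [h0, Real.sqrt_sq hd.le]
    have h1 := hq''.div (hq' 0) (by rw [h0]; positivity)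
    have h2 := hq''.div (((hq' 0).sqrt (by rw [h0]; positivity)).const_mul 2)
      (by rw [hs]; positivity)
    refine (h1.add (h2.const_mul A)).congr_deriv ?_
    rw [hs, h0]
    field_simp
    ring

/-- The Hessian bound obtained from touching `u` from below along a line. -/
theorem le_iteratedFDeriv_two_of_isLocalMin {F : Type*} [NormedAddCommGroup F]
    [InnerProductSpace ℝ F] {u : F → ℝ} {x : F} (hu : ContDiffAt ℝ 2 u x) (w : F) {δ ε c : ℝ}
    {G G' : ℝ → ℝ} (hG : ∀ᶠ t in 𝓝 (0 : ℝ), HasDerivAt G (G' t) t) (hG' : HasDerivAt G' c 0)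
    (hmin : IsLocalMin (fun t : ℝ => u (x + t • w) - δ * ‖x + t • w‖ ^ 2 - ε * G t) 0) :
    2 * δ * ‖w‖ ^ 2 + ε * c ≤ iteratedFDeriv ℝ 2 u x ![w, w] := by
  obtain ⟨h1, h2⟩ := hu.line_second_deriv w
  have e : ∀ t : ℝ, ‖x + t • w‖ ^ 2 = ‖x‖ ^ 2 + 2 * t * inner ℝ x w + t ^ 2 * ‖w‖ ^ 2 := by
    intro t
    rw [norm_add_sq_real, inner_smul_right, norm_smul, mul_pow, Real.norm_eq_abs, sq_abs]
    ring
  have h3 : ∀ t : ℝ, HasDerivAt (fun t : ℝ => ‖x + t • w‖ ^ 2)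
      (2 * inner ℝ x w + 2 * t * ‖w‖ ^ 2) t := by
    intro t
    simp only [e]
    refine (((((hasDerivAt_id t).const_mul 2).mul_const (inner ℝ x w)).const_add (‖x‖ ^ 2)).add
      ((hasDerivAt_pow 2 t).mul_const (‖w‖ ^ 2))).congr_deriv ?_
    simp
  have h4 : HasDerivAt (fun t : ℝ => 2 * inner ℝ x w + 2 * t * ‖w‖ ^ 2) (2 * ‖w‖ ^ 2) 0 := by
    simpa using (((hasDerivAt_id (0 : ℝ)).const_mul 2).mul_const (‖w‖ ^ 2)).const_add
      (2 * inner ℝ x w)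
  have h5 := hmin.second_deriv_nonneg
    (f' := fun t => fderiv ℝ u (x + t • w) w - δ * (2 * inner ℝ x w + 2 * t * ‖w‖ ^ 2) - ε * G' t)
    (by
      filter_upwards [h1, hG] with t a b
      exact (a.sub ((h3 t).const_mul δ)).sub (b.const_mul ε))
    ((h2.sub (h4.const_mul δ)).sub (hG'.const_mul ε))
  linarith

/-! ### Squared distance to `E` and its tangent spaces -/

/-- Near a nearest point `y` of `E`, the squared distance to `E` is bounded below along lines by an
explicit quadratic polynomial. -/
theorem eventually_quadratic_le_infDist_sq {F : Type*} [NormedAddCommGroup F]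
    [InnerProductSpace ℝ F] {E : Set F} (hE : IsCompact E) {x y : F} (hy : y ∈ E)
    (hxy : 0 < ‖x - y‖) (T : Submodule ℝ F) [T.HasOrthogonalProjection] (hN : x - y ∈ Tᗮ)
    {r C : ℝ} (hC : 0 ≤ C) (hCr : C * r ≤ 1 / 2) (hdr : ‖x - y‖ < r / 4)
    (hCd : 16 * C * ‖x - y‖ ≤ 1)
    (hT : ∀ z ∈ E, dist z y < r →
      ‖(z - y) - T.starProjection (z - y)‖ ≤ C * ‖z - y‖ ^ 2) (w : F) :
    ∀ᶠ t in 𝓝 (0 : ℝ), ‖x - y‖ ^ 2 + 2 * t * inner ℝ (x - y) w +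
      t ^ 2 * (‖w‖ ^ 2 - ‖T.starProjection w‖ ^ 2
        - 16 * C * ‖x - y‖ * ‖T.starProjection w‖ ^ 2) ≤
      Metric.infDist (x + t • w) E ^ 2 := by
  have hc : Tendsto (fun t : ℝ => ‖t • w‖) (𝓝 0) (𝓝 0) := by
    have : Continuous fun t : ℝ => ‖t • w‖ := by fun_prop
    simpa using this.tendsto 0
  filter_upwards [hc.eventually (gt_mem_nhds hxy),
    hc.eventually (gt_mem_nhds (show 0 < r / 4 by linarith))] with t ht1 ht2
  obtain ⟨z, hz, hzd⟩ := hE.exists_infDist_eq_dist ⟨y, hy⟩ (x + t • w)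
  have hP : ∀ v : F, ‖v‖ ^ 2 = ‖T.starProjection v‖ ^ 2 + ‖v - T.starProjection v‖ ^ 2 := by
    intro v
    have := Submodule.norm_sq_eq_add_norm_sq_starProjection v T
    rwa [Submodule.starProjection_orthogonal_val] at this
  have hzy : dist z y < r := by
    have h1 : dist (x + t • w) z ≤ dist (x + t • w) y := hzd ▸ Metric.infDist_le_dist_of_mem hy
    have h2 : dist (x + t • w) y ≤ ‖t • w‖ + ‖x - y‖ := by
      rw [dist_eq_norm, show x + t • w - y = t • w + (x - y) by abel]
      exact norm_add_le _ _
    have h3 := dist_triangle_left z y (x + t • w)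
    linarith
  have hs := hT z hz hzy
  set N := x - y with hNdef
  set d := ‖N‖ with hd
  set v := z - y with hv
  have hPN : T.starProjection N = 0 := T.starProjection_apply_eq_zero_iff.2 hN
  set p := T.starProjection v with hp
  set s := v - p with hsdef
  set q := T.starProjection w with hq
  -- From `‖s‖ ≤ C(‖p‖² + ‖s‖²)`, the last term is absorbed using `C‖s‖ ≤ C r ≤ 1/2`.
  have hs2 : ‖s‖ ≤ 2 * C * ‖p‖ ^ 2 := by
    have h1 := hP v
    rw [← hp, ← hsdef] at h1
    have h2 : ‖s‖ ≤ ‖v‖ :=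
      (sq_le_sq₀ (norm_nonneg _) (norm_nonneg _)).1 (by linarith [sq_nonneg ‖p‖])
    have h3 : ‖v‖ < r := by rwa [dist_eq_norm] at hzy
    have h4 : C * ‖s‖ ^ 2 ≤ 1 / 2 * ‖s‖ := by
      have : C * ‖s‖ ≤ 1 / 2 := (mul_le_mul_of_nonneg_left (h2.trans h3.le) hC).trans hCr
      nlinarith [norm_nonneg s]
    rw [h1] at hs
    linarith
  rw [hzd, dist_eq_norm, show x + t • w - z = N + t • w - v by rw [hNdef, hv]; abel,
    hP (N + t • w - v)]
  have e1 : T.starProjection (N + t • w - v) = t • q - p := by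
    rw [map_sub, map_add, map_smul, hPN, zero_add]
  have e2 : N + t • w - v - (t • q - p) = (N + t • (w - q)) - s := by
    rw [hsdef, smul_sub]; abel
  rw [e1, e2]
  have e3 : ‖N + t • (w - q)‖ ^ 2 = d ^ 2 + 2 * t * inner ℝ N w + t ^ 2 * (‖w‖ ^ 2 - ‖q‖ ^ 2) := by
    have h1 : inner ℝ N q = (0 : ℝ) :=
      (Submodule.mem_orthogonal' _ _).1 hN _ (T.starProjection_apply_mem w)
    rw [norm_add_sq_real, inner_smul_right, inner_sub_right, h1, norm_smul, mul_pow,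
      Real.norm_eq_abs, sq_abs, hP w]
    ring
  have e4 : ‖N + t • (w - q)‖ ≤ 2 * d := by
    have h1 : ‖w - q‖ ≤ ‖w‖ :=
      (sq_le_sq₀ (norm_nonneg _) (norm_nonneg _)).1 (by linarith [hP w, sq_nonneg ‖q‖])
    have h2 := norm_add_le N (t • (w - q))
    rw [norm_smul] at h2 ht1
    have h3 := mul_le_mul_of_nonneg_left h1 (norm_nonneg t)
    linarith
  have e5 : ‖N + t • (w - q)‖ ^ 2 - 4 * d * ‖s‖ ≤ ‖N + t • (w - q) - s‖ ^ 2 := by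
    have h1 := real_inner_le_norm (N + t • (w - q)) s
    have h2 := mul_le_mul_of_nonneg_right e4 (norm_nonneg s)
    rw [norm_sub_sq_real]
    nlinarith [sq_nonneg ‖s‖]
  have e6 : ‖p‖ ^ 2 ≤ 2 * ‖t • q - p‖ ^ 2 + 2 * (t ^ 2 * ‖q‖ ^ 2) := by
    have h1 : ‖p‖ ≤ ‖t • q‖ + ‖t • q - p‖ := by
      have := norm_sub_le (t • q) (t • q - p)
      simpa using this
    have h2 : ‖t • q‖ ^ 2 = t ^ 2 * ‖q‖ ^ 2 := by
      rw [norm_smul, mul_pow, Real.norm_eq_abs, sq_abs]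
    rw [← h2]
    nlinarith [norm_nonneg p, sq_nonneg (‖t • q‖ - ‖t • q - p‖)]
  have e7 : 4 * d * ‖s‖ ≤ 8 * C * d * (2 * ‖t • q - p‖ ^ 2 + 2 * (t ^ 2 * ‖q‖ ^ 2)) := by
    have h1 := mul_le_mul_of_nonneg_left hs2 (by positivity : 0 ≤ 4 * d)
    have h2 := mul_le_mul_of_nonneg_left e6 (by positivity : 0 ≤ 8 * C * d)
    linarith
  -- The tangential part of the squared distance pays for the `‖t • q - p‖²` part of the cross term.
  have e8 : 16 * C * d * ‖t • q - p‖ ^ 2 ≤ 1 * ‖t • q - p‖ ^ 2 :=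
    mul_le_mul_of_nonneg_right hCd (sq_nonneg _)
  rw [e3] at e5
  linarith

theorem norm_sub_starProjection_le_norm_sub {F : Type*} [NormedAddCommGroup F]
    [InnerProductSpace ℝ F] (T : Submodule ℝ F) [T.HasOrthogonalProjection] (v : F) {t : F}
    (ht : t ∈ T) : ‖v - T.starProjection v‖ ≤ ‖v - t‖ := by
  rw [Submodule.starProjection_minimal]
  exact ciInf_le ⟨0, by rintro _ ⟨a, rfl⟩; positivity⟩ (⟨t, ht⟩ : T)

/-- The linear inclusion of `ℝᵏ` as the first coordinates of `ℝⁿ`. -/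
noncomputable def firstCoordinates (k n : ℕ) : (Fin k → ℝ) →ₗ[ℝ] EuclideanSpace ℝ (Fin n) where
  toFun c := WithLp.toLp 2 fun i => if h : (i : ℕ) < k then c ⟨i, h⟩ else 0
  map_add' a b := by ext i; by_cases h : (i : ℕ) < k <;> simp [h]
  map_smul' a b := by ext i; by_cases h : (i : ℕ) < k <;> simp [h]

theorem exists_firstCoordinates_eq {k n : ℕ} {w : EuclideanSpace ℝ (Fin n)}
    (hw : ∀ i : Fin n, (k : ℤ) ≤ (i : ℤ) → w i = 0) : ∃ c, firstCoordinates k n c = w := by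
  refine ⟨fun j => if h : (j : ℕ) < n then w ⟨j, h⟩ else 0, ?_⟩
  ext i
  by_cases h : (i : ℕ) < k
  · simp [firstCoordinates, h]
  · simp [firstCoordinates, h, hw i (by exact_mod_cast not_lt.1 h)]

theorem firstCoordinates_apply_eq_zero {k n : ℕ} (c : Fin k → ℝ) (i : Fin n)
    (hi : (k : ℤ) ≤ (i : ℤ)) : firstCoordinates k n c i = 0 := by
  have : ¬ (i : ℕ) < k := not_lt.2 (by exact_mod_cast hi)
  simp [firstCoordinates, this]

/-- At each point `y` of `S` there is a `k`-dimensional subspace `T`, normal to the segments from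
`y` to the points whose projection on `E` is `y`, such that `E` is quadratically close to `y + T`
with uniform constants. -/
def HasUniformTangents {F : Type*} [NormedAddCommGroup F] [InnerProductSpace ℝ F]
    [FiniteDimensional ℝ F] (k : ℕ) (E : Set F) (r C : ℝ) (S : Set F) : Prop :=
  ∀ y ∈ S, ∃ T : Submodule ℝ F, Module.finrank ℝ T ≤ k ∧
    (∀ x, (∀ z ∈ E, dist x y ≤ dist x z) → x - y ∈ Tᗮ) ∧
    ∀ z ∈ E, dist z y < r → ‖(z - y) - T.starProjection (z - y)‖ ≤ C * ‖z - y‖ ^ 2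

theorem HasUniformTangents.mono {F : Type*} [NormedAddCommGroup F] [InnerProductSpace ℝ F]
    [FiniteDimensional ℝ F] {k : ℕ} {E : Set F} {r C r' C' : ℝ} {S S' : Set F}
    (h : HasUniformTangents k E r C S) (hr : r' ≤ r) (hC : C ≤ C') (hS : S' ⊆ S) :
    HasUniformTangents k E r' C' S' := by
  intro y hy
  obtain ⟨T, h1, h2, h3⟩ := h y (hS hy)
  exact ⟨T, h1, h2, fun z hz hzy => (h3 z hz (hzy.trans_le hr)).trans (by gcongr)⟩

/-- `T` is the image of `ℝᵏ × {0}` under the derivative of `Φ.symm`. Normality is the first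
variation of the distance along curves in `E`; quadratic closeness is Taylor's estimate, with `K` a
Lipschitz constant of that derivative and `L` one of `Φ`. -/
theorem exists_hasUniformTangents_nhds {n k : ℕ} {E : Set (EuclideanSpace ℝ (Fin n))}
    (Φ : OpenPartialHomeomorph (EuclideanSpace ℝ (Fin n)) (EuclideanSpace ℝ (Fin n)))
    {p : EuclideanSpace ℝ (Fin n)} (hp : p ∈ Φ.source) (hΦ : ContDiffOn ℝ ∞ Φ Φ.source)
    (hΨ : ContDiffOn ℝ ∞ Φ.symm Φ.target)
    (hE : ∀ x ∈ Φ.source, (x ∈ E ↔ ∀ i : Fin n, (k : ℤ) ≤ (i : ℤ) → Φ x i = 0)) :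
    ∃ r > 0, ∃ C ≥ 0, HasUniformTangents k E r C (E ∩ Metric.ball p r) := by
  have hΨ' : ∀ a ∈ Φ.target, ContDiffAt ℝ 2 Φ.symm a := fun a ha =>
    (hΨ.contDiffAt (Φ.open_target.mem_nhds ha)).of_le
      (mod_cast le_top : ((2 : ℕ∞) : WithTop ℕ∞) ≤ ∞)
  obtain ⟨K, t, ht, hK⟩ := ((hΨ' _ (Φ.map_source hp)).fderiv_right (m := 1)
    (by norm_num)).exists_lipschitzOnWith
  obtain ⟨L, s, hs, hL⟩ := ((hΦ.contDiffAt (Φ.open_source.mem_nhds hp)).of_le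
    (mod_cast le_top : ((1 : ℕ∞) : WithTop ℕ∞) ≤ ∞)).exists_lipschitzOnWith
  obtain ⟨ρ, hρ, hball⟩ := Metric.mem_nhds_iff.1
    (inter_mem ht (Φ.open_target.mem_nhds (Φ.map_source hp)))
  obtain ⟨R, hR, hball'⟩ := Metric.mem_nhds_iff.1
    (inter_mem (inter_mem hs (Φ.open_source.mem_nhds hp))
      ((Φ.continuousAt hp).preimage_mem_nhds (Metric.ball_mem_nhds _ hρ)))
  -- Half the radius keeps points within `R / 2` of `y` inside `ball p R`.
  refine ⟨R / 2, by positivity, K * L ^ 2, by positivity, ?_⟩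
  rintro y ⟨hyE, hy⟩
  have hyR : y ∈ Metric.ball p R := Metric.ball_subset_ball (by linarith) hy
  obtain ⟨⟨hys, hysrc⟩, hyρ⟩ := hball' hyR
  have hya : Φ y ∈ Φ.target := Φ.map_source hysrc
  have hDy := ((hΨ' _ hya).differentiableAt (by simp)).hasFDerivAt
  set D := fderiv ℝ Φ.symm (Φ y) with hD
  refine ⟨LinearMap.range (D.toLinearMap ∘ₗ firstCoordinates k n), ?_, ?_, ?_⟩
  · exact (LinearMap.finrank_range_le _).trans (by simp)
  · intro x hx
    rw [Submodule.mem_orthogonal']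
    rintro _ ⟨c, rfl⟩
    set w := firstCoordinates k n c with hw
    have hl : ∀ τ : ℝ, HasDerivAt (fun τ : ℝ => Φ y + τ • w) w τ := fun τ => by
      simpa using ((hasDerivAt_id τ).smul_const w).const_add (Φ y)
    have hl0 : Tendsto (fun τ : ℝ => Φ y + τ • w) (𝓝 0) (𝓝 (Φ y)) := by
      simpa using (hl 0).continuousAt.tendsto
    have hcurve : HasDerivAt (fun τ : ℝ => Φ.symm (Φ y + τ • w)) (D w) 0 := by
      have hDy' : HasFDerivAt Φ.symm D (Φ y + (0 : ℝ) • w) := by simpa using hDy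
      exact hDy'.comp_hasDerivAt (0 : ℝ) (hl 0)
    have h1 := (hcurve.const_sub x).norm_sq
    have hmin : IsLocalMin (fun τ : ℝ => ‖x - Φ.symm (Φ y + τ • w)‖ ^ 2) 0 := by
      filter_upwards [hl0.eventually (Φ.open_target.mem_nhds hya)] with τ hτ
      have hmem : Φ.symm (Φ y + τ • w) ∈ E := by
        refine (hE _ (Φ.map_target hτ)).2 fun i hi => ?_
        rw [Φ.right_inv hτ]
        simp [hw, firstCoordinates_apply_eq_zero c i hi, (hE y hysrc).1 hyE i hi]
      have h2 := hx _ hmem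
      simp only [dist_eq_norm] at h2
      simp only [zero_smul, add_zero, Φ.left_inv hysrc]
      gcongr
    have h3 := hmin.hasDerivAt_eq_zero h1
    simp only [zero_smul, add_zero, Φ.left_inv hysrc, inner_neg_right] at h3
    change inner ℝ (x - y) (D w) = 0
    linarith
  · intro z hz hzy
    have hzR : z ∈ Metric.ball p R := by
      have := dist_triangle z y p
      rw [Metric.mem_ball] at hy ⊢
      linarith
    obtain ⟨⟨hzs, hzsrc⟩, hzρ⟩ := hball' hzR
    obtain ⟨c, hc⟩ := exists_firstCoordinates_eq (k := k) (w := Φ z - Φ y) fun i hi => by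
      simp [(hE y hysrc).1 hyE i hi, (hE z hzsrc).1 hz i hi]
    refine (norm_sub_starProjection_le_norm_sub _ (z - y) (t := D (Φ z - Φ y))
      (LinearMap.mem_range.2 ⟨c, by simp [hc]⟩)).trans ?_
    have hseg : segment ℝ (Φ y) (Φ z) ⊆ Metric.ball (Φ p) ρ :=
      (convex_ball _ _).segment_subset hyρ hzρ
    have h1 := (convex_segment (𝕜 := ℝ) (Φ y) (Φ z)).norm_image_sub_le_of_norm_hasFDerivWithin_le'
      (f := Φ.symm) (f' := fderiv ℝ Φ.symm) (φ := D) (C := K * ‖Φ z - Φ y‖)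
      (fun a ha => ((hΨ' a (hball (hseg ha)).2).differentiableAt
        (by simp)).hasFDerivAt.hasFDerivWithinAt)
      (fun a ha => by
        refine (hK.norm_sub_le (hball (hseg ha)).1 (hball hyρ).1).trans ?_
        gcongr
        exact norm_sub_le_of_mem_segment ha)
      (left_mem_segment ℝ _ _) (right_mem_segment ℝ _ _)
    rw [Φ.left_inv hzsrc, Φ.left_inv hysrc] at h1
    have h2 := hL.norm_sub_le hzs hys
    calc _ ≤ _ := h1
      _ = K * ‖Φ z - Φ y‖ ^ 2 := by ring
      _ ≤ K * (L * ‖z - y‖) ^ 2 := by gcongr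
      _ = _ := by ring

theorem IsSmoothClosedSubmanifold.exists_hasUniformTangents {n k : ℕ}
    {E : Set (EuclideanSpace ℝ (Fin n))} (hE : IsSmoothClosedSubmanifold (k : ℤ) E) :
    ∃ r > 0, ∃ C ≥ 0, HasUniformTangents k E r C E := by
  refine hE.1.induction_on (p := fun S => ∃ r > 0, ∃ C ≥ 0, HasUniformTangents k E r C S)
    ⟨1, one_pos, 0, le_rfl, fun y hy => hy.elim⟩ ?_ ?_ ?_
  · rintro S S' hS ⟨r, hr, C, hC, h⟩
    exact ⟨r, hr, C, hC, h.mono le_rfl le_rfl hS⟩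
  · rintro S S' ⟨r, hr, C, hC, h⟩ ⟨r', hr', C', hC', h'⟩
    refine ⟨min r r', lt_min hr hr', max C C', hC.trans (le_max_left _ _), ?_⟩
    rintro y (hy | hy)
    · exact h.mono (min_le_left _ _) (le_max_left _ _) subset_rfl y hy
    · exact h'.mono (min_le_right _ _) (le_max_right _ _) subset_rfl y hy
  · intro p hp
    obtain ⟨Φ, hpΦ, hΦ, hΨ, hΦE⟩ := hE.2.2 p hp
    obtain ⟨r, hr, C, hC, h⟩ := exists_hasUniformTangents_nhds Φ hpΦ hΦ hΨ hΦE
    exact ⟨_, inter_mem_nhdsWithin E (Metric.ball_mem_nhds p hr), r, hr, C, hC, h⟩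

/-- Expand in an orthonormal basis of `T`, exchange the sums, and apply Bessel to each basis vector.
-/
theorem Orthonormal.sum_norm_sq_starProjection_le {F ι : Type*} [NormedAddCommGroup F]
    [InnerProductSpace ℝ F] [FiniteDimensional ℝ F] [Fintype ι] {w : ι → F} (hw : Orthonormal ℝ w)
    (T : Submodule ℝ F) : ∑ i, ‖T.starProjection (w i)‖ ^ 2 ≤ Module.finrank ℝ T := by
  set b := stdOrthonormalBasis ℝ T
  have h1 : ∀ i, ‖T.starProjection (w i)‖ ^ 2 = ∑ j, ‖inner ℝ (w i) (b j : F)‖ ^ 2 := by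
    intro i
    have := b.sum_sq_norm_inner_right (T.orthogonalProjectionOnto (w i))
    rw [Submodule.starProjection_apply, Submodule.norm_coe, ← this]
    refine Finset.sum_congr rfl fun j _ => ?_
    rw [Submodule.inner_orthogonalProjectionOnto_eq_of_mem_left, real_inner_comm]
  simp only [h1]
  rw [Finset.sum_comm]
  calc _ ≤ ∑ j, ‖(b j : F)‖ ^ 2 :=
        Finset.sum_le_sum fun j _ => hw.sum_inner_products_le (b j : F)
    _ = ∑ _j : Fin (Module.finrank ℝ T), (1 : ℝ) :=
        Finset.sum_congr rfl fun j _ => by rw [Submodule.norm_coe, b.orthonormal.1 j, one_pow]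
    _ = Module.finrank ℝ T := by simp

/-! ### Excluding local minima -/

theorem not_isLocalMin_sub_norm_sq {n m : ℕ} (hm : 0 < m) (hmn : m ≤ n)
    {u : EuclideanSpace ℝ (Fin n) → ℝ} {x : EuclideanSpace ℝ (Fin n)} (hu : ContDiffAt ℝ 2 u x)
    (hsum : ∑ i ∈ Finset.Icc 1 m, orderedEigenvalue (hessianMatrix u x) i ≤ 0) {δ : ℝ}
    (hδ : 0 < δ) : ¬ IsLocalMin (fun y => u y - δ * ‖y‖ ^ 2) x := by
  intro hmin
  obtain ⟨w, hw, hsw⟩ := exists_orthonormal_sum_orderedEigenvalue hmn (isHermitian_hessianMatrix hu)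
  simp only [sum_hessianMatrix_eq] at hsw
  have h1 : ∀ i, 2 * δ ≤ iteratedFDeriv ℝ 2 u x ![w i, w i] := by
    intro i
    have hc : Tendsto (fun t : ℝ => x + t • w i) (𝓝 0) (𝓝 x) := by
      have : Continuous fun t : ℝ => x + t • w i := by fun_prop
      simpa using this.tendsto 0
    have := le_iteratedFDeriv_two_of_isLocalMin hu (w i) (δ := δ) (ε := 0) (c := 0)
      (G := fun _ => 0) (G' := fun _ => 0)
      (Eventually.of_forall fun t => hasDerivAt_const t _) (hasDerivAt_const _ _) (by
        filter_upwards [hc.eventually hmin] with t ht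
        simpa using ht)
    simpa [hw.1 i] using this
  have h2 : ∑ _i : Fin m, 2 * δ ≤ ∑ i, iteratedFDeriv ℝ 2 u x ![w i, w i] :=
    Finset.sum_le_sum fun i _ => h1 i
  rw [← hsw] at h2
  have h3 : 0 < (m : ℝ) * (2 * δ) := by positivity
  simp at h2
  linarith

/-- The barrier `log q + A √q` in terms of the squared distance `q` to `E`. -/
noncomputable def barrier {F : Type*} [PseudoMetricSpace F] (A : ℝ) (E : Set F) (x : F) : ℝ :=
  Real.log (Metric.infDist x E ^ 2) + A * √(Metric.infDist x E ^ 2)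

theorem HasUniformTangents.not_isLocalMin_sub_barrier {n k : ℕ} (hkn : k + 2 ≤ n)
    {E : Set (EuclideanSpace ℝ (Fin n))} (hE : IsCompact E) {r C A ε δ : ℝ} (hC : 0 ≤ C)
    (hCr : C * r ≤ 1 / 2) (hT : HasUniformTangents k E r C E) {x : EuclideanSpace ℝ (Fin n)}
    (hx : 0 < Metric.infDist x E) (hxr : Metric.infDist x E < r / 4)
    (hxC : 16 * C * Metric.infDist x E ≤ 1) (hxk : 16 * C * k * Metric.infDist x E ≤ 1 / 2)
    (hA : 64 * C * k < A)
    {u : EuclideanSpace ℝ (Fin n) → ℝ} (hu : ContDiffAt ℝ 2 u x)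
    (hsum : ∑ i ∈ Finset.Icc 1 (k + 2), orderedEigenvalue (hessianMatrix u x) i ≤ 0)
    (hδ : 0 ≤ δ) (hε : 0 < ε) :
    ¬ IsLocalMin (fun y => u y - δ * ‖y‖ ^ 2 - ε * barrier A E y) x := by
  intro hmin
  obtain ⟨w, hw, hsw⟩ := exists_orthonormal_sum_orderedEigenvalue hkn (isHermitian_hessianMatrix hu)
  simp only [sum_hessianMatrix_eq] at hsw
  have hne : E.Nonempty := by
    by_contra h
    simp [Set.not_nonempty_iff_eq_empty.1 h] at hx
  obtain ⟨y, hy, hxy⟩ := hE.exists_infDist_eq_dist hne x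
  obtain ⟨T, hTk, hTN, hTE⟩ := hT y hy
  have hN := hTN x fun z hz => hxy ▸ Metric.infDist_le_dist_of_mem hz
  rw [hxy, dist_eq_norm] at hx hxr hxC hxk
  have hA0 : 0 < A := lt_of_le_of_lt (by positivity) hA
  have hquad := fun v =>
    eventually_quadratic_le_infDist_sq hE hy hx T hN hC hCr hxr hxC hTE v
  set d := ‖x - y‖ with hd
  set b : Fin (k + 2) → ℝ := fun i =>
    1 - ‖T.starProjection (w i)‖ ^ 2 - 16 * C * d * ‖T.starProjection (w i)‖ ^ 2 with hb
  set β : Fin (k + 2) → ℝ := fun i => inner ℝ (x - y) (w i) with hβ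
  have h1 : ∀ i, ε * (2 * b i / d ^ 2 - 4 * β i ^ 2 / d ^ 4 +
      A * (b i / d - β i ^ 2 / d ^ 3)) ≤ iteratedFDeriv ℝ 2 u x ![w i, w i] := by
    intro i
    have hc : Tendsto (fun t : ℝ => x + t • w i) (𝓝 0) (𝓝 x) := by
      have : Continuous fun t : ℝ => x + t • w i := by fun_prop
      simpa using this.tendsto 0
    obtain ⟨f', hf', hf''⟩ := hasDerivAt_log_add_sqrt_quadratic hx A (β i) (b i)
    have hpos : ∀ᶠ t in 𝓝 (0 : ℝ), 0 < d ^ 2 + 2 * t * β i + t ^ 2 * b i := by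
      have : Continuous fun t : ℝ => d ^ 2 + 2 * t * β i + t ^ 2 * b i := by fun_prop
      exact (this.tendsto 0).eventually (lt_mem_nhds (by simp; positivity))
    -- Replacing the barrier by its minorant, equal at `t = 0`, preserves the local minimum.
    have h2 := le_iteratedFDeriv_two_of_isLocalMin hu (w i) (δ := δ) (ε := ε) hf' hf'' (by
        filter_upwards [hc.eventually hmin, hquad (w i), hpos] with t ht hqt hp
        rw [hw.1 i, one_pow] at hqt
        simp only [barrier, hxy, dist_eq_norm, ← hd] at ht
        have h3 : Real.log (d ^ 2 + 2 * t * β i + t ^ 2 * b i) ≤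
          Real.log (Metric.infDist (x + t • w i) E ^ 2) := Real.log_le_log hp hqt
        have h4 := mul_le_mul_of_nonneg_left (Real.sqrt_le_sqrt hqt) hA0.le
        have h5 := mul_le_mul_of_nonneg_left (add_le_add h3 h4) hε.le
        simp only [zero_smul, add_zero, mul_zero, zero_mul, zero_pow two_ne_zero]
        linarith)
    have h3 : 0 ≤ 2 * δ * ‖w i‖ ^ 2 := by positivity
    linarith
  have h2 := Finset.sum_le_sum fun i (_ : i ∈ Finset.univ) => h1 i
  rw [← hsw] at h2
  have hsβ : ∑ i, β i ^ 2 ≤ d ^ 2 := by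
    have := hw.sum_inner_products_le (x - y) (s := Finset.univ)
    simpa [hβ, real_inner_comm] using this
  have hsτ := (hw.sum_norm_sq_starProjection_le T).trans (Nat.cast_le.2 hTk)
  set τ := ∑ i, ‖T.starProjection (w i)‖ ^ 2
  have hsb : 2 - 16 * C * d * k ≤ ∑ i, b i := by
    have e : ∑ i, b i = (k + 2) - τ - 16 * C * d * τ := by
      simp [hb, Finset.sum_sub_distrib, ← Finset.mul_sum, τ]
    have := mul_le_mul_of_nonneg_left hsτ (by positivity : 0 ≤ 16 * C * d)
    rw [e]
    linarith
  have e : ∑ i, ε * (2 * b i / d ^ 2 - 4 * β i ^ 2 / d ^ 4 + A * (b i / d - β i ^ 2 / d ^ 3)) =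
      ε * (2 * (∑ i, b i) / d ^ 2 - 4 * (∑ i, β i ^ 2) / d ^ 4 +
        A * ((∑ i, b i) / d - (∑ i, β i ^ 2) / d ^ 3)) := by
    simp only [← Finset.mul_sum, Finset.sum_add_distrib, Finset.sum_sub_distrib,
      ← Finset.sum_div]
  rw [e] at h2
  have h3 : 2 * (2 - 16 * C * d * k) / d ^ 2 - 4 * d ^ 2 / d ^ 4 +
      A * ((2 - 16 * C * d * k) / d - d ^ 2 / d ^ 3) ≤
      2 * (∑ i, b i) / d ^ 2 - 4 * (∑ i, β i ^ 2) / d ^ 4 +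
        A * ((∑ i, b i) / d - (∑ i, β i ^ 2) / d ^ 3) := by
    gcongr
  -- The `1/d²` terms cancel. As `16 C k d ≤ 1/2`, the rest is positive once `A / 2 > 32 C k`.
  have h4 : 2 * (2 - 16 * C * d * k) / d ^ 2 - 4 * d ^ 2 / d ^ 4 +
      A * ((2 - 16 * C * d * k) / d - d ^ 2 / d ^ 3) =
      (A * (1 - 16 * C * k * d) - 32 * C * k) / d := by
    field_simp
    ring
  have h5 : 0 < (A * (1 - 16 * C * k * d) - 32 * C * k) / d := by
    refine div_pos ?_ hx
    nlinarith
  have h6 := mul_pos hε (h5.trans_le (h4 ▸ h3))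
  linarith

/-! ### Forcing a local minimum near `E` -/

/-- A function bounded below on a bounded open set minus `E` whose infimum is not attained there
and is exceeded by a fixed amount on `frontier Ω \ E`: subtracting a small multiple of the barrier
produces a local minimum arbitrarily close to `E`. -/
theorem exists_isLocalMin_sub_barrier {F : Type*} [NormedAddCommGroup F] [NormedSpace ℝ F]
    [ProperSpace F] {E Ω : Set F} (hE : IsCompact E) (hΩ : IsOpen Ω)
    (hΩb : Bornology.IsBounded Ω) {v : F → ℝ} (hv : ContinuousOn v (closure Ω \ E)) {a M A r : ℝ}
    (hr : 0 < r) (hA : 0 ≤ A) (ha : IsGLB (v '' (Ω \ E)) a) (hav : ∀ x ∈ Ω \ E, a < v x)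
    (haM : a < M) (hM : ∀ x ∈ frontier Ω \ E, M ≤ v x) :
    ∃ x ∈ Ω \ E, 0 < Metric.infDist x E ∧ Metric.infDist x E < r ∧
      ∃ ε > 0, IsLocalMin (fun y => v y - ε * barrier A E y) x := by
  have hcl : IsCompact (closure Ω) := hΩb.isCompact_closure
  have hcla : ∀ x ∈ closure Ω, x ∉ E → x ∈ Ω ∨ M ≤ v x := by
    intro x hx hxE
    by_cases h : x ∈ Ω
    · exact .inl h
    · exact .inr (hM x ⟨⟨hx, by rwa [hΩ.interior_eq]⟩, hxE⟩)
  have hgt : ∀ x ∈ closure Ω, x ∉ E → a < v x := fun x hx hxE =>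
    (hcla x hx hxE).elim (fun h => hav x ⟨h, hxE⟩) fun h => haM.trans_le h
  set K := closure Ω \ Metric.thickening r E with hK
  have hKE : ∀ x ∈ K, x ∉ E := fun x hx h => hx.2 (Metric.self_subset_thickening hr E h)
  have hKc : IsCompact K := hcl.diff Metric.isOpen_thickening
  obtain ⟨c, hac, hcM, hcK⟩ : ∃ c, a < c ∧ c ≤ M ∧ ∀ x ∈ K, c ≤ v x := by
    rcases K.eq_empty_or_nonempty with h | h
    · exact ⟨M, haM, le_rfl, by simp [h]⟩
    · obtain ⟨z, hz, hzmin⟩ := hKc.exists_isMinOn h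
        (hv.mono fun x hx => ⟨hx.1, hKE x hx⟩)
      exact ⟨min M (v z), lt_min haM (hgt z hz.1 (hKE z hz)), min_le_left _ _,
        fun x hx => (min_le_right _ _).trans (hzmin hx)⟩
  obtain ⟨_, ⟨x₁, hx₁, rfl⟩, -, hx₁c⟩ := ha.exists_between (show a < (a + c) / 2 by linarith)
  have hx₁T : x₁ ∈ Metric.thickening r E := by
    by_contra h
    have := hcK x₁ ⟨subset_closure hx₁.1, h⟩
    linarith
  have hEne : E.Nonempty := by
    obtain ⟨z, hz, -⟩ := Metric.mem_thickening_iff.1 hx₁T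
    exact ⟨z, hz⟩
  have hpos : ∀ x, x ∉ E → 0 < Metric.infDist x E := fun x hx =>
    (hE.isClosed.notMem_iff_infDist_pos hEne).1 hx
  have hx₁r : Metric.infDist x₁ E < r := (Metric.mem_thickening_iff_infDist_lt hEne).1 hx₁T
  set g : ℝ → ℝ := fun d => Real.log (d ^ 2) + A * √(d ^ 2) with hg
  have hgmono : ∀ d e : ℝ, 0 < d → d ≤ e → g d ≤ g e := by
    intro d e hd hde
    simp only [hg]
    gcongr
  have hbg : ∀ x, barrier A E x = g (Metric.infDist x E) := fun x => rfl
  have hg0 : Tendsto g (𝓝[>] 0) atBot := by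
    have h1 : Tendsto (fun d : ℝ => Real.log (d ^ 2)) (𝓝[>] 0) atBot := by
      have : Tendsto (fun d : ℝ => 2 * Real.log d) (𝓝[>] 0) atBot :=
        Real.tendsto_log_nhdsGT_zero.const_mul_atBot two_pos
      simpa [Real.log_pow] using this
    have h2 : Tendsto (fun d : ℝ => A * √(d ^ 2)) (𝓝[>] 0) (𝓝 0) := by
      have : Continuous fun d : ℝ => A * √(d ^ 2) := by fun_prop
      simpa using (this.tendsto 0).mono_left nhdsWithin_le_nhds
    exact h1.atBot_add h2
  -- Such `ε` keeps `f x₁` below `c - ε * g r`, so a minimizer over the shell `D` has `v < c`; this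
  -- excludes `frontier Ω` and `infDist = r`.
  obtain ⟨ε, hε, hεc⟩ : ∃ ε > 0, ε * (g r - g (Metric.infDist x₁ E)) < (c - a) / 2 := by
    have h1 : Tendsto (fun ε : ℝ => ε * (g r - g (Metric.infDist x₁ E))) (𝓝[>] 0) (𝓝 0) := by
      have : Continuous fun ε : ℝ => ε * (g r - g (Metric.infDist x₁ E)) := by fun_prop
      simpa using (this.tendsto 0).mono_left nhdsWithin_le_nhds
    obtain ⟨ε, h, hε⟩ := ((h1.eventually (gt_mem_nhds (show 0 < (c - a) / 2 by linarith))).and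
      self_mem_nhdsWithin).exists
    exact ⟨ε, hε, h⟩
  set f : F → ℝ := fun y => v y - ε * barrier A E y with hf
  have hx₁f : f x₁ < c - ε * g r := by
    simp only [hf, hbg]
    linarith
  -- Since `v > a`, this makes `f > f x₁` where `infDist = ρ`, excluding the inner boundary.
  obtain ⟨ρ, hρ₁, hρ, hρ0⟩ : ∃ ρ, ρ < Metric.infDist x₁ E ∧ ε * g ρ < a - f x₁ ∧ 0 < ρ := by
    obtain ⟨ρ, ⟨h1, h2⟩, h3⟩ := (((hg0.eventually (eventually_lt_atBot ((a - f x₁) / ε))).and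
      (nhdsWithin_le_nhds (gt_mem_nhds (hpos x₁ hx₁.2)))).and self_mem_nhdsWithin).exists
    rw [lt_div_iff₀' hε] at h1
    exact ⟨ρ, h2, h1, h3⟩
  have hcont : Continuous fun x => Metric.infDist x E := Metric.continuous_infDist_pt E
  set D := closure Ω ∩ (fun x => Metric.infDist x E) ⁻¹' Set.Icc ρ r with hD
  have hDc : IsCompact D := hcl.inter_right (isClosed_Icc.preimage hcont)
  have hDE : ∀ x ∈ D, x ∉ E := by
    intro x hx h
    have := hx.2.1
    simp only [Metric.infDist_zero_of_mem h] at this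
    linarith
  have hfc : ContinuousOn f D := by
    refine (hv.mono fun x hx => ⟨hx.1, hDE x hx⟩).sub (continuousOn_const.mul ?_)
    refine ContinuousOn.add (ContinuousOn.log (hcont.pow 2).continuousOn fun x hx => ?_)
      (by fun_prop)
    have := hρ0.trans_le hx.2.1
    positivity
  obtain ⟨x₀, hx₀, hx₀min⟩ := hDc.exists_isMinOn
    ⟨x₁, subset_closure hx₁.1, hρ₁.le, hx₁r.le⟩ hfc
  have hx₀f : f x₀ ≤ f x₁ := hx₀min ⟨subset_closure hx₁.1, hρ₁.le, hx₁r.le⟩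
  have hx₀0 : 0 < Metric.infDist x₀ E := hρ0.trans_le hx₀.2.1
  have hx₀g := mul_le_mul_of_nonneg_left (hgmono _ _ hx₀0 hx₀.2.2) hε.le
  have hx₀c : v x₀ < c := by
    have : f x₀ = v x₀ - ε * g (Metric.infDist x₀ E) := rfl
    linarith
  have hx₀Ω : x₀ ∈ Ω := (hcla x₀ hx₀.1 (hDE x₀ hx₀)).resolve_right (by linarith)
  have hx₀r : Metric.infDist x₀ E < r := by
    rw [← Metric.mem_thickening_iff_infDist_lt hEne]
    by_contra h
    have := hcK x₀ ⟨hx₀.1, h⟩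
    linarith
  have hx₀ρ : ρ < Metric.infDist x₀ E := by
    refine lt_of_le_of_ne hx₀.2.1 fun h => ?_
    have h1 : f x₀ = v x₀ - ε * g (Metric.infDist x₀ E) := rfl
    rw [← h] at h1
    have := hgt x₀ hx₀.1 (hDE x₀ hx₀)
    linarith
  refine ⟨x₀, ⟨hx₀Ω, hDE x₀ hx₀⟩, hx₀0, hx₀r, ε, hε, ?_⟩
  refine hx₀min.isLocalMin ?_
  filter_upwards [hΩ.mem_nhds hx₀Ω, (isOpen_Ioo.preimage hcont).mem_nhds ⟨hx₀ρ, hx₀r⟩] with y h1 h2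
  exact ⟨subset_closure h1, h2.1.le, h2.2.le⟩

/-! ### The minimum principle -/

theorem proposition1p1 (n : ℕ) (hn : 2 ≤ n) (k : ℤ) (hk₁ : -1 ≤ k) (hk₂ : k ≤ (n : ℤ) - 2)
    (E : Set (EuclideanSpace ℝ (Fin n))) (hE : IsSmoothClosedSubmanifold k E)
    (Ω : Set (EuclideanSpace ℝ (Fin n))) (hΩ_open : IsOpen Ω) (hΩ_conn : IsConnected Ω)
    (hΩ_bdd : Bornology.IsBounded Ω)
    (u : EuclideanSpace ℝ (Fin n) → ℝ)
    (hu_C2 : ContDiffOn ℝ 2 u (Ω \ E)) (hu_C0 : ContinuousOn u (closure Ω \ E))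
    (hu_hess : ∀ x ∈ Ω \ E,
      ∑ i ∈ Finset.Icc 1 (k + 2).toNat, orderedEigenvalue (hessianMatrix u x) i ≤ 0)
    (hu_bdd : BddBelow (u '' (Ω \ E))) :
    ∀ x ∈ Ω \ E, (⨅ z ∈ frontier Ω \ E, (u z : EReal)) ≤ (u x : EReal) := by
  intro x hx
  by_contra! hlt
  obtain ⟨m, hxm, hmu⟩ := EReal.lt_iff_exists_real_btwn.1 hlt
  have hxm' : u x < m := by exact_mod_cast hxm
  have hm : ∀ z ∈ frontier Ω \ E, m ≤ u z := fun z hz => by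
    exact_mod_cast hmu.le.trans (iInf₂_le z hz)
  obtain ⟨R, hR⟩ := (hΩ_bdd.closure).exists_norm_le
  have hR1 : 0 < R ^ 2 + 1 := by positivity
  set δ := (m - u x) / (R ^ 2 + 1) with hδdef
  have hδ : 0 < δ := div_pos (by linarith) hR1
  have hδR : δ * R ^ 2 < m - u x := by
    have : δ * (R ^ 2 + 1) = m - u x := div_mul_cancel₀ _ hR1.ne'
    linarith
  have hopen : IsOpen (Ω \ E) := hΩ_open.sdiff hE.1.isClosed
  have hC2 : ∀ y ∈ Ω \ E, ContDiffAt ℝ 2 u y := fun y hy => hu_C2.contDiffAt (hopen.mem_nhds hy)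
  set v := fun y => u y - δ * ‖y‖ ^ 2 with hv
  have hnorm : ∀ y ∈ closure Ω, δ * ‖y‖ ^ 2 ≤ δ * R ^ 2 := fun y hy => by
    have := hR y hy
    gcongr
  have hvlow : ∀ y ∈ closure Ω, u y - δ * R ^ 2 ≤ v y := fun y hy => by
    have := hnorm y hy
    simp only [hv]
    linarith
  have hvbdd : BddBelow (v '' (Ω \ E)) := by
    obtain ⟨B, hB⟩ := hu_bdd
    refine ⟨B - δ * R ^ 2, ?_⟩
    rintro _ ⟨y, hy, rfl⟩
    have := hB ⟨y, hy, rfl⟩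
    have := hvlow y (subset_closure hy.1)
    linarith
  have hglb := isGLB_csInf (Set.Nonempty.image v ⟨x, hx⟩) hvbdd
  have hle : ∀ y ∈ Ω \ E, sInf (v '' (Ω \ E)) ≤ v y := fun y hy => hglb.1 ⟨y, hy, rfl⟩
  have hvx : v x ≤ u x := by
    simp only [hv]
    have : 0 ≤ δ * ‖x‖ ^ 2 := by positivity
    linarith
  have hlt' : ∀ y ∈ Ω \ E, sInf (v '' (Ω \ E)) < v y := by
    intro y hy
    refine lt_of_le_of_ne (hle y hy) fun h => ?_
    refine not_isLocalMin_sub_norm_sq (by omega) (by omega) (hC2 y hy) (hu_hess y hy) hδ ?_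
    filter_upwards [hopen.mem_nhds hy] with z hz
    exact h.symm.trans_le (hle z hz)
  have hvc : ContinuousOn v (closure Ω \ E) := hu_C0.sub (by fun_prop)
  have key : ∀ r > 0, ∀ A ≥ 0, ∃ y ∈ Ω \ E, 0 < Metric.infDist y E ∧ Metric.infDist y E < r ∧
      ∃ ε > 0, IsLocalMin (fun y => v y - ε * barrier A E y) y := fun r hr A hA =>
    exists_isLocalMin_sub_barrier hE.1 hΩ_open hΩ_bdd hvc hr hA hglb hlt'
      (M := m - δ * R ^ 2) ((hle x hx).trans_lt (by linarith))
      (fun z hz => (sub_le_sub_right (hm z hz) _).trans (hvlow z hz.1.1))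
  rcases lt_or_ge k 0 with hk | hk
  -- For `k = -1`, `E` is empty and `infDist` to it is `0`, contradicting positivity.
  · obtain ⟨y, -, hy, -⟩ := key 1 one_pos 0 le_rfl
    simp [hE.2.1 hk] at hy
  · lift k to ℕ using hk
    have hk' : ((k : ℤ) + 2).toNat = k + 2 := by omega
    rw [hk'] at hu_hess
    obtain ⟨r, hr, C, hC, hT⟩ := hE.exists_hasUniformTangents
    obtain ⟨s, hs, hsr, hs1, hs2, hs3⟩ : ∃ s > 0, s ≤ r ∧ C * s ≤ 1 / 2 ∧
        16 * C * s ≤ 1 ∧ 16 * C * k * s ≤ 1 / 2 := by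
      have h : ∀ c d : ℝ, 0 < d → ∀ᶠ s in 𝓝[>] (0 : ℝ), c * s ≤ d := by
        intro c d hd
        have : Continuous fun s : ℝ => c * s := by fun_prop
        exact nhdsWithin_le_nhds ((this.tendsto 0).eventually (ge_mem_nhds (by simpa using hd)))
      obtain ⟨s, h0, h1, h2, h3, h4⟩ := (eventually_mem_nhdsWithin.and ((h 1 r hr).and
        ((h C (1 / 2) (by norm_num)).and ((h (16 * C) 1 one_pos).and
        (h (16 * C * k) (1 / 2) (by norm_num)))))).exists
      exact ⟨s, h0, by linarith, h2, h3, h4⟩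
    have hA : 0 ≤ 64 * C * k + 1 := by positivity
    obtain ⟨y, hy, hy0, hyr, ε, hε, hmin⟩ := key (s / 4) (by positivity) _ hA
    exact (hT.mono hsr le_rfl subset_rfl).not_isLocalMin_sub_barrier (by omega) hE.1 hC hs1 hy0 hyr
      ((mul_le_mul_of_nonneg_left (by linarith) (by positivity)).trans hs2)
      ((mul_le_mul_of_nonneg_left (by linarith) (by positivity)).trans hs3)
      (lt_add_one _) (hC2 y hy) (hu_hess y hy) hδ.le hε hmin
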